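/- Consider a Markov decision process with finite state space $\mathcal S$, finite nonempty action space $\mathcal A$, transition probabilities $P(\cdot\mid s,a)$ and rewards $r(s,a)\in\mathbb R$; no assumption is made on its chain structure (general, i.e. multichain). All norms are sup norms. A policy $\pi$ assigns to each state $s$ a probability distribution $\pi(\cdot\mid s)$ on $\mathcal A$; it induces $r^\pi(s)=\sum_a\pi(a\mid s)r(s,a)$, the matrix $\mathcal P^\pi(s,s')=\sum_a\pi(a\mid s)P(s'\mid s,a)$, the operator $T^\pi V=r^\pi+\mathcal P^\pi V$ and the average reward $g^\pi(s)=\liminf_{n\to\infty}\frac1n\mathbb E_\pi\big[\sum_{t=0}^{n-1}r(s_t,a_t)\mid s_0=s\big]$. The Bellman optimality operator is $TV(s)=\max_a\{r(s,a)+\sum_{s'}P(s'\mid s,a)V(s')\}$. Let $(g^\star,h^\star)$ be a solution of the modified Bellman equations, i.e. for all $s$, $$\max_a\sum_{s'}P(s'\mid s,a)g^\star(s')=g^\star(s),\qquad \max_a\Big\{r(s,a)+\sum_{s'}P(s'\mid s,a)h^\star(s')\Big\}=h^\star(s)+g^\star(s),$$ and some policy $\pi^\star$ attains both maxima simultaneously,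 i.e. $\mathcal P^{\pi^\star}g^\star=g^\star$ and $r^{\pi^\star}+\mathcal P^{\pi^\star}h^\star=h^\star+g^\star$. Let $V^0\in\mathbb R^{\mathcal S}$, let $V^k=\tfrac12V^{k-1}+\tfrac12TV^{k-1}$ for $k\ge1$ (Relaxed Value Iteration with $\lambda_k=1/2$), and for each $k\ge 0$ let $\pi_k$ be a greedy policy, i.e. $T^{\pi_k}V^k=TV^k$. Put $$\epsilon=\inf\big\{\|\mathcal P^{\pi}g^\star-g^\star\| : \pi\text{ a deterministic policy with }\mathcal P^\pi g^\star\ne g^\star\big\}\in[0,\infty]$$ (with $\inf\emptyset=\infty$) and $$K=\frac{2\|r\|+4\|V^0\|+16\|V^0-h^\star\|+2\|g^\star\|}{\epsilon}$$ (with $K=0$ if $\epsilon=\infty$). Then $\epsilon>0$, and for every integer $k>K$, $$\|g^\star-g^{\pi_k}\|\le\|TV^k-V^k-g^\star\|\le\frac{4\|V^0-h^\star\|}{\sqrt{\pi\,(k-K)}},$$ where $\pi$ under the root is the constant $3.14159\ldots$ -/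

import Mathlib

/-- A Markov decision process with state space `S` and action space `A`: transition
probabilities `P s a` (a probability distribution on `S`) and rewards `r s a`. -/
structure MDP (S A : Type*) [Fintype S] [Fintype A] where
  P : S → A → stdSimplex ℝ S
  r : S → A → ℝ

namespace MDP

variable {S A : Type*} [Fintype S] [Fintype A]

/-- A stationary randomized policy: `(π s).1 a` is the probability of action `a` in state `s`. -/
abbrev Policy (_M : MDP S A) : Type _ := S → stdSimplex ℝ A

open Classical in
/-- The policy that chooses the action `d s` in state `s` with probability one. -/
noncomputable def ofDet (M : MDP S A) (d : S → A) : M.Policy :=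
  fun s => ⟨Pi.single (d s) 1, single_mem_stdSimplex ℝ (d s)⟩

/-- The set of all deterministic policies. -/
def detPolicies (M : MDP S A) : Set M.Policy := Set.range M.ofDet

/-- The reward vector `r^π` induced by a policy. -/
noncomputable def polReward (M : MDP S A) (π : M.Policy) : S → ℝ :=
  fun s => ∑ a, (π s).1 a * M.r s a

/-- The transition matrix `P^π` induced by a policy. -/
noncomputable def polMatrix (M : MDP S A) (π : M.Policy) : Matrix S S ℝ :=
  Matrix.of fun s s' => ∑ a, (π s).1 a * (M.P s a).1 s'

/-- The Bellman consistency operator `T^π V = r^π + P^π V`. -/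
noncomputable def polOp (M : MDP S A) (π : M.Policy) (V : S → ℝ) : S → ℝ :=
  M.polReward π + (M.polMatrix π).mulVec V

/-- The Bellman optimality operator `T`. -/
noncomputable def bellman [Nonempty A] (M : MDP S A) (V : S → ℝ) : S → ℝ :=
  fun s => Finset.univ.sup' Finset.univ_nonempty
    fun a => M.r s a + ∑ s', (M.P s a).1 s' * V s'

/-- The probability of the trajectory `(s_0, a_0), …, (s_{n-1}, a_{n-1})` when `s_0` has
distribution `μ`, actions are drawn from `π` and states from the transition probabilities. -/
noncomputable def trajProb (M : MDP S A) (π : M.Policy) :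
    (n : ℕ) → (S → ℝ) → (Fin n → S × A) → ℝ
  | 0, _, _ => 1
  | n + 1, μ, τ =>
      μ (τ 0).1 * (π (τ 0).1).1 (τ 0).2 *
        trajProb M π n (M.P (τ 0).1 (τ 0).2).1 (Fin.tail τ)

open Classical in
/-- The expected total reward over `n` steps started at `s`,
`E_π [∑_{t<n} r(s_t, a_t) | s_0 = s]`. -/
noncomputable def expTotalReward (M : MDP S A) (π : M.Policy) (n : ℕ) (s : S) : ℝ :=
  ∑ τ : Fin n → S × A, M.trajProb π n (Pi.single s 1) τ * ∑ t, M.r (τ t).1 (τ t).2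

/-- The average reward `g^π` of a policy. -/
noncomputable def avgReward (M : MDP S A) (π : M.Policy) : S → ℝ :=
  fun s => Filter.liminf (fun n : ℕ => 1 / (n : ℝ) * M.expTotalReward π n s) Filter.atTop

/-- `(g, h)` is a solution of the modified Bellman equations: both equations hold, and some
policy attains the two maxima simultaneously. -/
structure IsModifiedBellmanSolution [Nonempty A] (M : MDP S A) (g h : S → ℝ) : Prop where
  first : ∀ s, (Finset.univ.sup' Finset.univ_nonempty
    fun a => ∑ s', (M.P s a).1 s' * g s') = g s
  second : ∀ s, (Finset.univ.sup' Finset.univ_nonempty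
    fun a => M.r s a + ∑ s', (M.P s a).1 s' * h s') = h s + g s
  attained : ∃ π : M.Policy,
    (M.polMatrix π).mulVec g = g ∧ M.polReward π + (M.polMatrix π).mulVec h = h + g

/-- Relaxed value iteration `V^k = λ_k V^{k-1} + (1 - λ_k) T V^{k-1}` started at `V0`. -/
noncomputable def relaxedVI [Nonempty A] (M : MDP S A) (lam : ℕ → ℝ) (V0 : S → ℝ) :
    ℕ → S → ℝ
  | 0 => V0
  | k + 1 => lam (k + 1) • relaxedVI M lam V0 k
      + (1 - lam (k + 1)) • M.bellman (relaxedVI M lam V0 k)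

/-- `π` is greedy for `V`: `T^π V = T V`. -/
def IsGreedy [Nonempty A] (M : MDP S A) (π : M.Policy) (V : S → ℝ) : Prop :=
  M.polOp π V = M.bellman V

/-- The policy gap: the infimum of `‖P^π g - g‖` over the deterministic policies `π` with
`P^π g ≠ g`, equal to `∞` if there are none. -/
noncomputable def policyGap (M : MDP S A) (g : S → ℝ) : ENNReal :=
  ⨅ π ∈ M.detPolicies \ {π | (M.polMatrix π).mulVec g = g},
    ENNReal.ofReal ‖(M.polMatrix π).mulVec g - g‖

/-- The threshold `K = (2‖r‖ + 4‖V0‖ + 16‖V0 - h‖ + 2‖g‖) / ε`, with `K = 0` if `ε = ∞`.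
All norms are sup norms. -/
noncomputable def threshold (M : MDP S A) (g h V0 : S → ℝ) : ℝ :=
  (ENNReal.ofReal (2 * ‖M.r‖ + 4 * ‖V0‖ + 16 * ‖V0 - h‖ + 2 * ‖g‖) / M.policyGap g).toReal

end MDP

/-! Write D = ‖V0 - h‖. The operator T is nonexpansive, and since one action attains both maxima,
T(h + c g) = h + (c + 1) g for c ≥ 0; hence V^k stays within D of h + (k/2) g
(`norm_relaxedVI_sub_le`). An action that does not preserve the gain loses at least ε of it
(`policyGap_le_loss`), which costs (k/2) ε in the one-step value, while at most 2 D can be regained.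
So from some step k₀ ≤ K on, gain-preserving actions suffice to attain T V^k.

On such actions, subtracting c g from V only shifts the value by c g. Therefore x_j = V^(k₀+j) -
((k₀+j)/2) g and y_j = T V^(k₀+j) - ((k₀+j)/2 + 1) g satisfy x_(j+1) = (x_j + y_j)/2 and ‖y_i - y_j‖
≤ ‖x_i - x_j‖: a Krasnoselskii-Mann orbit, with y_j - x_j = T V^(k₀+j) - V^(k₀+j) - g. Its rate
(`krasnoselskiiMann_residual_le`) comes from a Pascal-type recursion ending in a central binomial
coefficient.

For k > k₀ domination is strict, so a greedy policy preserves g; iterating its operator then drifts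
by g per step up to the residual, which bounds ‖g - g^π‖. -/

/-! ### Central binomial coefficients -/

/-- An upper bound of the central binomial coefficient from the Wallis product. -/
theorem centralBinom_div_four_pow_le (n : ℕ) (hn : 0 < n) :
    (n.centralBinom : ℝ) / 4 ^ n ≤ 1 / Real.sqrt (Real.pi * n) := by
  have hW := Real.Wallis.le_W n
  rw [Real.Wallis.W_eq_factorial_ratio] at hW
  have hc : (n.centralBinom : ℝ) * (n.factorial : ℝ) ^ 2 = ((2 * n).factorial : ℝ) := by
    have := Nat.choose_mul_factorial_mul_factorial (n := 2 * n) (k := n) (by omega)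
    rw [show 2 * n - n = n by omega] at this
    rw [Nat.centralBinom, ← this]
    push_cast
    ring
  have hn' : (0 : ℝ) < n := by exact_mod_cast hn
  have hf : (0 : ℝ) < n.factorial := by exact_mod_cast n.factorial_pos
  have hb : (0 : ℝ) < n.centralBinom := by exact_mod_cast n.centralBinom_pos
  have hpi := Real.pi_pos
  rw [← hc] at hW
  set b : ℝ := (n.centralBinom : ℝ)
  have h4 : (2 : ℝ) ^ (4 * n) = (4 ^ n) ^ 2 := by
    rw [pow_mul, ← pow_mul 4, mul_comm n 2, pow_mul]; norm_num
  rw [h4] at hW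
  set F : ℝ := 4 ^ n with hF
  have hFpos : 0 < F := by positivity
  have hW' : (2 * n + 1) ^ 2 * Real.pi * b ^ 2 ≤ 4 * (n + 1) * F ^ 2 := by
    have e : F ^ 2 * (n.factorial : ℝ) ^ 4 / ((b * (n.factorial : ℝ) ^ 2) ^ 2 * (2 * n + 1))
        = F ^ 2 / (b ^ 2 * (2 * n + 1)) := by
      field_simp
    rw [e, le_div_iff₀ (by positivity)] at hW
    have h2 : ((2 * n + 1) / (2 * n + 2) * (Real.pi / 2) * (b ^ 2 * (2 * n + 1)) : ℝ)
        = (2 * n + 1) ^ 2 * Real.pi * b ^ 2 / (4 * (n + 1)) := by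
      field_simp; ring
    rw [h2, div_le_iff₀ (by positivity)] at hW
    linarith
  have key : b ^ 2 * (Real.pi * n) ≤ F ^ 2 := by
    -- The slack is 4 n (n + 1) ≤ (2 n + 1)².
    have h1 : 4 * (n + 1 : ℝ) * (b ^ 2 * (Real.pi * n)) ≤ 4 * (n + 1) * F ^ 2 := by
      refine le_trans ?_ hW'
      have : 0 < Real.pi * b ^ 2 := by positivity
      nlinarith
    exact le_of_mul_le_mul_left h1 (by positivity)
  have hs : 0 < Real.sqrt (Real.pi * n) := Real.sqrt_pos.2 (by positivity)
  rw [div_le_div_iff₀ hFpos hs, one_mul]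
  refine le_of_sq_le_sq ?_ hFpos.le
  rw [mul_pow, Real.sq_sqrt (by positivity)]
  exact key

/-! ### Rate of Krasnoselskii-Mann iterations -/

section KrasnoselskiiMann

variable {E : Type*} [NormedAddCommGroup E] [NormedSpace ℝ E]

/-- The number of sign sequences counted in the bound of `‖x m - x (m + d)‖`. -/
def innerWindow (m d : ℕ) : ℕ := ∑ i ∈ Finset.range d, (2 * m + d).choose (m + 1 + i)

/-- The number of sign sequences counted in the bound of `‖x m - y (m + d)‖`. -/
def outerWindow (m d : ℕ) : ℕ := ∑ i ∈ Finset.range (d + 2), (2 * m + d).choose (m + i)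

/-- Pascal's rule mirrors the halving in the iteration: this identity matches the passage from x (m
+ d) to x (m + d + 1), and `outerWindow_succ` the one from x m to x (m + 1). -/
theorem innerWindow_succ (m d : ℕ) :
    innerWindow m (d + 1) = innerWindow m d + outerWindow m d := by
  unfold innerWindow outerWindow
  have h1 : ∀ i, (2 * m + (d + 1)).choose (m + 1 + i)
      = (2 * m + d).choose (m + i) + (2 * m + d).choose (m + 1 + i) := by
    intro i
    rw [show 2 * m + (d + 1) = (2 * m + d) + 1 by ring, show m + 1 + i = (m + i) + 1 by ring,
      Nat.choose_succ_succ']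
  simp only [h1, Finset.sum_add_distrib]
  rw [Finset.sum_range_succ (fun i => (2 * m + d).choose (m + i)) (d + 1),
    Finset.sum_range_succ (fun i => (2 * m + d).choose (m + 1 + i)) d,
    show m + 1 + d = m + (d + 1) by ring]
  ring

theorem outerWindow_succ (m d : ℕ) :
    outerWindow (m + 1) d = innerWindow m (d + 1) + outerWindow m (d + 1) := by
  unfold innerWindow outerWindow
  have h1 : ∀ i, (2 * (m + 1) + d).choose (m + 1 + i)
      = (2 * m + (d + 1)).choose (m + i) + (2 * m + (d + 1)).choose (m + 1 + i) := by
    intro i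
    rw [show 2 * (m + 1) + d = (2 * m + (d + 1)) + 1 by ring,
      show m + 1 + i = (m + i) + 1 by ring, Nat.choose_succ_succ']
  simp only [h1, Finset.sum_add_distrib]
  rw [Finset.sum_range_succ (fun i => (2 * m + (d + 1)).choose (m + i)) (d + 2),
    Finset.sum_range_succ (fun i => (2 * m + (d + 1)).choose (m + 1 + i)) (d + 1),
    show m + 1 + (d + 1) = m + (d + 2) by ring]
  ring

theorem outerWindow_zero_left (d : ℕ) : outerWindow 0 d = 2 ^ d := by
  unfold outerWindow
  simp [Finset.sum_range_succ _ (d + 1), Nat.sum_range_choose]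

/-- By symmetry of row 2m + 1, both Pascal summands of the central coefficient are equal. -/
theorem outerWindow_zero_right (m : ℕ) :
    2 * outerWindow m 0 = (m + 1).centralBinom := by
  have h1 : (2 * (m + 1)).choose (m + 1)
      = (2 * m + 1).choose m + (2 * m + 1).choose (m + 1) := Nat.choose_succ_succ' _ _
  have h2 : (2 * m + 1).choose m = (2 * m + 1).choose (m + 1) :=
    Nat.choose_symm_half m |>.symm
  have h3 : (2 * m + 1).choose (m + 1) = (2 * m).choose m + (2 * m).choose (m + 1) :=
    Nat.choose_succ_succ' _ _
  simp only [outerWindow, Nat.centralBinom, Finset.sum_range_succ, Finset.sum_range_zero]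
  simp only [add_zero, zero_add]
  omega

theorem norm_sub_half_le {x y z : E} {A B : ℝ} (hy : ‖x - y‖ ≤ A) (hz : ‖x - z‖ ≤ B) :
    ‖x - ((1 / 2 : ℝ) • y + (1 / 2 : ℝ) • z)‖ ≤ (A + B) / 2 := by
  have e : x - ((1 / 2 : ℝ) • y + (1 / 2 : ℝ) • z)
      = (1 / 2 : ℝ) • (x - y) + (1 / 2 : ℝ) • (x - z) := by
    module
  rw [e]
  refine (norm_add_le _ _).trans ?_
  rw [norm_smul, norm_smul, Real.norm_of_nonneg (by norm_num)]
  linarith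

variable {x y : ℕ → E} {C : ℝ}

/-- Expanding the later point x (m + d + 1) bounds x-x distances, by induction on d. Expanding x (m
+ 1) bounds x-y distances, by induction on m: the y-y distance that appears is traded for an x-x
distance by nonexpansiveness. The constant C enters only at m = 0. -/
theorem krasnoselskiiMann_window_bounds
    (hx : ∀ n, x (n + 1) = (1 / 2 : ℝ) • x n + (1 / 2 : ℝ) • y n)
    (hxy : ∀ m n, ‖y m - y n‖ ≤ ‖x m - x n‖) (hC : ∀ n, ‖x 0 - y n‖ ≤ C) (m : ℕ) :
    (∀ d, ‖x m - x (m + d)‖ ≤ C * innerWindow m d / 2 ^ (2 * m + d)) ∧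
    (∀ d, ‖x m - y (m + d)‖ ≤ C * outerWindow m d / 2 ^ (2 * m + d)) := by
  have inner_of_outer : ∀ m : ℕ,
      (∀ d, ‖x m - y (m + d)‖ ≤ C * outerWindow m d / 2 ^ (2 * m + d)) →
      ∀ d, ‖x m - x (m + d)‖ ≤ C * innerWindow m d / 2 ^ (2 * m + d) := by
    intro m hB d
    induction d with
    | zero => simp [innerWindow]
    | succ d ih =>
      rw [← add_assoc, hx]
      refine (norm_sub_half_le ih (hB d)).trans (le_of_eq ?_)
      rw [innerWindow_succ, ← add_assoc, pow_succ]
      push_cast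
      field_simp
  have outer : ∀ m d, ‖x m - y (m + d)‖ ≤ C * outerWindow m d / 2 ^ (2 * m + d) := by
    intro m
    induction m with
    | zero =>
      intro d
      rw [outerWindow_zero_left]
      simpa using hC d
    | succ m ih =>
      intro d
      have hA := inner_of_outer m ih (d + 1)
      have hB := ih (d + 1)
      rw [← add_assoc, add_right_comm] at hA hB
      rw [norm_sub_rev] at hA hB
      have hA' : ‖y (m + 1 + d) - y m‖ ≤ C * innerWindow m (d + 1) / 2 ^ (2 * m + (d + 1)) :=
        (hxy _ _).trans hA
      rw [hx, norm_sub_rev]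
      refine (norm_sub_half_le hB hA').trans (le_of_eq ?_)
      rw [outerWindow_succ, show 2 * (m + 1) + d = 2 * m + (d + 1) + 1 by ring,
        pow_succ _ (2 * m + (d + 1))]
      push_cast
      field_simp
      ring
  exact ⟨inner_of_outer m (outer m), outer m⟩

/-- The sharp rate of asymptotic regularity of Krasnoselskii-Mann iterations with step `1 / 2`,
where `y n` plays the role of the image of `x n` under a nonexpansive map. -/
theorem krasnoselskiiMann_residual_le
    (hx : ∀ n, x (n + 1) = (1 / 2 : ℝ) • x n + (1 / 2 : ℝ) • y n)
    (hxy : ∀ m n, ‖y m - y n‖ ≤ ‖x m - x n‖) (hC : ∀ n, ‖x 0 - y n‖ ≤ C) (m : ℕ) :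
    ‖x m - y m‖ ≤ 2 * C / Real.sqrt (Real.pi * (m + 1)) := by
  have hC0 : 0 ≤ C := (norm_nonneg _).trans (hC 0)
  have h := (krasnoselskiiMann_window_bounds hx hxy hC m).2 0
  have hw : ((2 * outerWindow m 0 : ℕ) : ℝ) = (m + 1).centralBinom := by
    exact_mod_cast outerWindow_zero_right m
  have hc := centralBinom_div_four_pow_le (m + 1) m.succ_pos
  rw [← hw] at hc
  push_cast at hc
  rw [add_zero, add_zero, pow_mul] at h
  refine h.trans ?_
  have e : C * (outerWindow m 0 : ℝ) / (2 ^ 2) ^ m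
      = 2 * C * (2 * (outerWindow m 0 : ℝ) / 4 ^ (m + 1)) := by
    rw [pow_succ]; norm_num; field_simp; ring
  rw [e, div_eq_mul_one_div (2 * C)]
  exact mul_le_mul_of_nonneg_left hc (by positivity)

end KrasnoselskiiMann

/-! ### Total and average reward of a policy -/

/-- If `u n` is eventually within `d + b / n` of `c`, then its lower limit is within `d` of `c`. -/
theorem abs_liminf_sub_le {u : ℕ → ℝ} {c d b : ℝ}
    (hu : ∀ᶠ n : ℕ in Filter.atTop, |u n - c| ≤ d + b / n) :
    |Filter.liminf u Filter.atTop - c| ≤ d := by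
  have hη : ∀ η > 0, ∀ᶠ n : ℕ in Filter.atTop, |u n - c| ≤ d + η := by
    intro η h
    have ht : Filter.Tendsto (fun n : ℕ => b / (n : ℝ)) Filter.atTop (nhds 0) :=
      tendsto_const_div_atTop_nhds_zero_nat b
    filter_upwards [hu, ht.eventually (gt_mem_nhds h)] with n h1 h2
    linarith
  have hlow : Filter.IsBoundedUnder (· ≥ ·) Filter.atTop u :=
    ⟨c - (d + 1), Filter.eventually_map.2 <| (hη 1 one_pos).mono fun n hn => by
      have := (abs_le.1 hn).1
      simp only [ge_iff_le]
      linarith⟩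
  have hup : Filter.IsBoundedUnder (· ≤ ·) Filter.atTop u :=
    ⟨c + (d + 1), Filter.eventually_map.2 <| (hη 1 one_pos).mono fun n hn => by
      have := (abs_le.1 hn).2
      linarith⟩
  rw [abs_le]
  constructor
  · refine le_of_forall_pos_sub_le fun η h => ?_
    have : c - (d + η) ≤ Filter.liminf u Filter.atTop :=
      Filter.le_liminf_of_le hup.isCoboundedUnder_ge <| (hη η h).mono fun n hn => by
        have := (abs_le.1 hn).1
        linarith
    linarith
  · refine le_of_forall_pos_le_add fun η h => ?_
    have : Filter.liminf u Filter.atTop ≤ c + (d + η) :=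
      Filter.liminf_le_of_le hlow fun b hb => by
        obtain ⟨n, h1, h2⟩ := (hb.and (hη η h)).exists
        have := (abs_le.1 h2).2
        linarith
    linarith

namespace MDP

variable {S A : Type*} [Fintype S] [Fintype A]

/-- The expected value of `V` at the next state after action `a` in state `s`. -/
noncomputable def nextExp (M : MDP S A) (s : S) (a : A) (V : S → ℝ) : ℝ :=
  ∑ s', (M.P s a).1 s' * V s'

theorem abs_weighted_sum_le {ι : Type*} [Fintype ι] (p : stdSimplex ℝ ι) {f : ι → ℝ} {C : ℝ}
    (hf : ∀ i, |f i| ≤ C) : |∑ i, p.1 i * f i| ≤ C := by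
  calc |∑ i, p.1 i * f i| ≤ ∑ i, |p.1 i * f i| := Finset.abs_sum_le_sum_abs _ _
    _ ≤ ∑ i, p.1 i * C := Finset.sum_le_sum fun i _ => by
        rw [abs_mul, abs_of_nonneg (p.2.1 i)]
        exact mul_le_mul_of_nonneg_left (hf i) (p.2.1 i)
    _ = C := by rw [← Finset.sum_mul, p.2.2, one_mul]

theorem abs_nextExp_le (M : MDP S A) (s : S) (a : A) (V : S → ℝ) :
    |M.nextExp s a V| ≤ ‖V‖ :=
  abs_weighted_sum_le _ fun s' => norm_le_pi_norm V s'

theorem nextExp_add (M : MDP S A) (s : S) (a : A) (V W : S → ℝ) :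
    M.nextExp s a (V + W) = M.nextExp s a V + M.nextExp s a W := by
  simp [nextExp, mul_add, Finset.sum_add_distrib]

theorem nextExp_sub (M : MDP S A) (s : S) (a : A) (V W : S → ℝ) :
    M.nextExp s a (V - W) = M.nextExp s a V - M.nextExp s a W := by
  simp [nextExp, mul_sub, Finset.sum_sub_distrib]

theorem nextExp_smul (M : MDP S A) (s : S) (a : A) (c : ℝ) (V : S → ℝ) :
    M.nextExp s a (c • V) = c * M.nextExp s a V := by
  simp only [nextExp, Pi.smul_apply, smul_eq_mul, Finset.mul_sum]
  exact Finset.sum_congr rfl fun _ _ => by ring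

theorem polMatrix_mulVec_apply (M : MDP S A) (π : M.Policy) (V : S → ℝ) (s : S) :
    (M.polMatrix π).mulVec V s = ∑ a, (π s).1 a * M.nextExp s a V := by
  simp only [Matrix.mulVec, dotProduct, polMatrix, Matrix.of_apply, nextExp, Finset.sum_mul,
    Finset.mul_sum]
  rw [Finset.sum_comm]
  exact Finset.sum_congr rfl fun _ _ => Finset.sum_congr rfl fun _ _ => by ring

theorem polOp_apply (M : MDP S A) (π : M.Policy) (V : S → ℝ) (s : S) :
    M.polOp π V s = ∑ a, (π s).1 a * (M.r s a + M.nextExp s a V) := by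
  simp only [polOp, Pi.add_apply, polMatrix_mulVec_apply, polReward, mul_add,
    Finset.sum_add_distrib]

theorem norm_polMatrix_mulVec_le (M : MDP S A) (π : M.Policy) (V : S → ℝ) :
    ‖(M.polMatrix π).mulVec V‖ ≤ ‖V‖ := by
  refine (pi_norm_le_iff_of_nonneg (norm_nonneg _)).2 fun s => ?_
  rw [polMatrix_mulVec_apply, Real.norm_eq_abs]
  exact abs_weighted_sum_le _ fun a => M.abs_nextExp_le s a V

theorem sum_traj_succ {n : ℕ} (F : (Fin (n + 1) → S × A) → ℝ) :
    ∑ τ, F τ = ∑ s, ∑ a, ∑ τ : Fin n → S × A, F (Fin.cons (s, a) τ) := by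
  rw [← (Fin.consEquiv fun _ : Fin (n + 1) => S × A).sum_comp, Fintype.sum_prod_type,
    Fintype.sum_prod_type]
  rfl

theorem trajProb_cons (M : MDP S A) (π : M.Policy) (n : ℕ) (μ : S → ℝ) (s : S) (a : A)
    (τ : Fin n → S × A) :
    M.trajProb π (n + 1) μ (Fin.cons (s, a) τ)
      = μ s * (π s).1 a * M.trajProb π n (M.P s a).1 τ := rfl

theorem sum_trajProb (M : MDP S A) (π : M.Policy) (n : ℕ) :
    ∀ μ : S → ℝ, ∑ s, μ s = 1 → ∑ τ, M.trajProb π n μ τ = 1 := by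
  induction n with
  | zero => intro μ _; simp [trajProb]
  | succ n ih =>
    intro μ hμ
    simp only [sum_traj_succ, trajProb_cons, ← Finset.mul_sum, ih _ (M.P _ _).2.2, mul_one,
      (π _).2.2]
    exact hμ

/-- The expected total reward over `n` steps when the initial state has distribution `μ`. -/
noncomputable def totalRewardFrom (M : MDP S A) (π : M.Policy) (n : ℕ) (μ : S → ℝ) : ℝ :=
  ∑ τ : Fin n → S × A, M.trajProb π n μ τ * ∑ t, M.r (τ t).1 (τ t).2

/-- Condition on the first state and action; the remaining trajectory has total mass one and starts
from the distribution `M.P s a`, which is why general initial distributions are needed. -/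
theorem totalRewardFrom_succ (M : MDP S A) (π : M.Policy) (n : ℕ) (μ : S → ℝ) :
    M.totalRewardFrom π (n + 1) μ
      = ∑ s, μ s * ∑ a, (π s).1 a * (M.r s a + M.totalRewardFrom π n (M.P s a).1) := by
  unfold totalRewardFrom
  simp only [sum_traj_succ, trajProb_cons, Fin.sum_univ_succ, Fin.cons_zero, Fin.cons_succ,
    Finset.mul_sum]
  refine Finset.sum_congr rfl fun s _ => Finset.sum_congr rfl fun a _ => ?_
  rw [mul_add, mul_add]
  have h1 := M.sum_trajProb π n (M.P s a).1 (M.P s a).2.2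
  calc _ = ∑ τ, (μ s * (π s).1 a * M.r s a * M.trajProb π n (M.P s a).1 τ
        + μ s * ((π s).1 a * ∑ t, M.trajProb π n (M.P s a).1 τ * M.r (τ t).1 (τ t).2)) := by
        refine Finset.sum_congr rfl fun τ _ => ?_
        simp only [← Finset.mul_sum]
        ring
    _ = _ := by
        rw [Finset.sum_add_distrib, ← Finset.mul_sum, h1]
        simp only [← Finset.mul_sum]
        ring

theorem totalRewardFrom_eq_sum (M : MDP S A) (π : M.Policy) (n : ℕ) (μ : S → ℝ) :
    M.totalRewardFrom π n μ = ∑ s, μ s * M.expTotalReward π n s := by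
  classical
  cases n with
  | zero => simp [totalRewardFrom, expTotalReward]
  | succ n =>
    rw [totalRewardFrom_succ]
    refine Finset.sum_congr rfl fun s _ => ?_
    congr 1
    have h := M.totalRewardFrom_succ π n (Pi.single s 1)
    simp only [Pi.single_apply, ite_mul, one_mul, zero_mul, Finset.sum_ite_eq',
      Finset.mem_univ, if_true] at h
    rw [← h]
    simp only [totalRewardFrom, expTotalReward]

theorem expTotalReward_zero (M : MDP S A) (π : M.Policy) : M.expTotalReward π 0 = 0 := by
  funext s
  simp [expTotalReward]

theorem expTotalReward_succ (M : MDP S A) (π : M.Policy) (n : ℕ) :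
    M.expTotalReward π (n + 1) = M.polOp π (M.expTotalReward π n) := by
  classical
  funext s
  have h := M.totalRewardFrom_succ π n (Pi.single s 1)
  simp only [Pi.single_apply, ite_mul, one_mul, zero_mul, Finset.sum_ite_eq',
    Finset.mem_univ, if_true, totalRewardFrom_eq_sum] at h
  rw [polOp_apply]
  exact h

/-- Since P^π g = g, the error e_n obeys e_(n+1) = (T^π V - V - g) + P^π e_n with e_0 = -V. -/
theorem norm_expTotalReward_sub_le (M : MDP S A) (π : M.Policy) {g : S → ℝ}
    (hg : (M.polMatrix π).mulVec g = g) (V : S → ℝ) (n : ℕ) :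
    ‖M.expTotalReward π n - (n : ℝ) • g - V‖ ≤ n * ‖M.polOp π V - V - g‖ + ‖V‖ := by
  induction n with
  | zero => simp [expTotalReward_zero]
  | succ n ih =>
    have e : M.expTotalReward π (n + 1) - ((n + 1 : ℕ) : ℝ) • g - V
        = (M.polOp π V - V - g)
          + (M.polMatrix π).mulVec (M.expTotalReward π n - (n : ℝ) • g - V) := by
      rw [expTotalReward_succ, Matrix.mulVec_sub, Matrix.mulVec_sub, Matrix.mulVec_smul, hg]
      simp only [polOp]
      push_cast
      module
    rw [e]
    refine (norm_add_le _ _).trans ?_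
    have := (M.norm_polMatrix_mulVec_le π _).trans ih
    push_cast
    linarith

/-- If `P^π g = g`, the average reward of `π` differs from `g` by at most the residual of
`T^π` at any `V`. -/
theorem norm_sub_avgReward_le (M : MDP S A) (π : M.Policy) {g : S → ℝ}
    (hg : (M.polMatrix π).mulVec g = g) (V : S → ℝ) :
    ‖g - M.avgReward π‖ ≤ ‖M.polOp π V - V - g‖ := by
  refine (pi_norm_le_iff_of_nonneg (norm_nonneg _)).2 fun s => ?_
  rw [Pi.sub_apply, norm_sub_rev, Real.norm_eq_abs]
  -- One ‖V‖ is the initial error, the other comes from dropping V from the difference.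
  refine abs_liminf_sub_le (b := 2 * ‖V‖) ?_
  filter_upwards [Filter.eventually_gt_atTop 0] with n hn
  have hn' : (0 : ℝ) < n := by exact_mod_cast hn
  have h1 := (norm_le_pi_norm _ s).trans (M.norm_expTotalReward_sub_le π hg V n)
  have h2 := norm_le_pi_norm V s
  simp only [Pi.sub_apply, Pi.smul_apply, smul_eq_mul, Real.norm_eq_abs] at h1 h2
  have h3 : |M.expTotalReward π n s - n * g s| ≤ n * ‖M.polOp π V - V - g‖ + 2 * ‖V‖ := by
    rw [abs_le] at *
    constructor <;> linarith
  have e : 1 / (n : ℝ) * M.expTotalReward π n s - g s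
      = (M.expTotalReward π n s - n * g s) / n := by
    field_simp
  rw [e, abs_div, abs_of_pos hn', div_le_iff₀ hn']
  refine h3.trans (le_of_eq ?_)
  field_simp

end MDP

/-! ### Policy gap and Bellman operator -/

namespace MDP

variable {S A : Type*} [Fintype S] [Fintype A]

/-- This passes from a randomized policy to the individual actions in its support. -/
theorem eq_of_weighted_sum_eq {ι : Type*} [Fintype ι] (p : stdSimplex ℝ ι) {f : ι → ℝ} {c : ℝ}
    (hf : ∀ i, f i ≤ c) (h : ∑ i, p.1 i * f i = c) {i : ι} (hi : p.1 i ≠ 0) : f i = c := by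
  have h0 : ∑ j, p.1 j * (c - f j) = 0 := by
    simp only [mul_sub, Finset.sum_sub_distrib, h, ← Finset.sum_mul, p.2.2, one_mul, sub_self]
  have h1 := (Finset.sum_eq_zero_iff_of_nonneg fun j _ =>
    mul_nonneg (p.2.1 j) (sub_nonneg.2 (hf j))).1 h0 i (Finset.mem_univ i)
  rcases mul_eq_zero.1 h1 with h2 | h2
  · exact absurd h2 hi
  · linarith

theorem exists_ne_zero_of_stdSimplex {ι : Type*} [Fintype ι] (p : stdSimplex ℝ ι) :
    ∃ i, p.1 i ≠ 0 := by
  by_contra! h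
  have := p.2.2
  simp [h] at this

theorem ofDet_mulVec_apply (M : MDP S A) (d : S → A) (V : S → ℝ) (s : S) :
    (M.polMatrix (M.ofDet d)).mulVec V s = M.nextExp s (d s) V := by
  classical
  rw [polMatrix_mulVec_apply]
  simp [ofDet, Pi.single_apply]

theorem policyGap_pos (M : MDP S A) (g : S → ℝ) : 0 < M.policyGap g := by
  -- There are finitely many deterministic policies, so the infimum is a minimum of positive numbers
  -- (or ∞).
  have hfin : (M.detPolicies \ {π | (M.polMatrix π).mulVec g = g}).Finite :=
    (Set.finite_range _).subset Set.sdiff_subset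
  have e : M.policyGap g
      = hfin.toFinset.inf fun π => ENNReal.ofReal ‖(M.polMatrix π).mulVec g - g‖ := by
    simp only [policyGap, Finset.inf_eq_iInf, Set.Finite.mem_toFinset]
  rw [e, Finset.lt_inf_iff ENNReal.zero_lt_top]
  intro π hπ
  rw [Set.Finite.mem_toFinset] at hπ
  exact ENNReal.ofReal_pos.2 (norm_pos_iff.2 (sub_ne_zero.2 hπ.2))

theorem policyGap_le_of_ne_top (M : MDP S A) (g : S → ℝ) (hg : M.policyGap g ≠ ⊤) :
    M.policyGap g ≤ ENNReal.ofReal (2 * ‖g‖) := by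
  obtain ⟨π, hπ⟩ : (M.detPolicies \ {π | (M.polMatrix π).mulVec g = g}).Nonempty := by
    by_contra hne
    rw [Set.not_nonempty_iff_eq_empty] at hne
    exact hg (by rw [policyGap, hne]; simp)
  refine (iInf₂_le π hπ).trans (ENNReal.ofReal_le_ofReal ?_)
  have := M.norm_polMatrix_mulVec_le π g
  linarith [norm_sub_le ((M.polMatrix π).mulVec g) g]

variable [Nonempty A]

theorem le_bellman (M : MDP S A) (V : S → ℝ) (s : S) (a : A) :
    M.r s a + M.nextExp s a V ≤ M.bellman V s :=
  Finset.le_sup' (fun a => M.r s a + ∑ s', (M.P s a).1 s' * V s') (Finset.mem_univ a)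

theorem exists_bellman_eq (M : MDP S A) (V : S → ℝ) (s : S) :
    ∃ a, M.bellman V s = M.r s a + M.nextExp s a V := by
  obtain ⟨a, -, ha⟩ := Finset.exists_mem_eq_sup' Finset.univ_nonempty
    (fun a => M.r s a + ∑ s', (M.P s a).1 s' * V s')
  exact ⟨a, ha⟩

theorem norm_bellman_sub_le (M : MDP S A) (V W : S → ℝ) :
    ‖M.bellman V - M.bellman W‖ ≤ ‖V - W‖ := by
  have key : ∀ (V W : S → ℝ) s, M.bellman V s - M.bellman W s ≤ ‖V - W‖ := by
    intro V W s
    obtain ⟨a, ha⟩ := M.exists_bellman_eq V s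
    have h1 := M.le_bellman W s a
    have h2 := (abs_le.1 (M.abs_nextExp_le s a (V - W))).2
    rw [nextExp_sub] at h2
    linarith
  refine (pi_norm_le_iff_of_nonneg (norm_nonneg _)).2 fun s => ?_
  rw [Pi.sub_apply, Real.norm_eq_abs, abs_le]
  have := key V W s
  have := key W V s
  rw [norm_sub_rev] at this
  constructor <;> linarith

/-! ### Gain-preserving actions and the shifted iteration -/

namespace IsModifiedBellmanSolution

variable {M : MDP S A} {g h : S → ℝ}

theorem nextExp_gain_le (hsol : M.IsModifiedBellmanSolution g h) (s : S) (a : A) :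
    M.nextExp s a g ≤ g s := by
  rw [← hsol.first s]
  exact Finset.le_sup' (fun a => ∑ s', (M.P s a).1 s' * g s') (Finset.mem_univ a)

theorem bellman_bias (hsol : M.IsModifiedBellmanSolution g h) (s : S) :
    M.bellman h s = h s + g s :=
  hsol.second s

theorem exists_action (hsol : M.IsModifiedBellmanSolution g h) (s : S) :
    ∃ a, M.nextExp s a g = g s ∧ M.r s a + M.nextExp s a h = h s + g s := by
  obtain ⟨π, hg, hh⟩ := hsol.attained
  obtain ⟨a, ha⟩ := exists_ne_zero_of_stdSimplex (π s)
  refine ⟨a, ?_, ?_⟩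
  · refine eq_of_weighted_sum_eq (π s) (fun a => hsol.nextExp_gain_le s a) ?_ ha
    rw [← polMatrix_mulVec_apply, hg]
  · refine eq_of_weighted_sum_eq (π s) (f := fun a => M.r s a + M.nextExp s a h)
      (fun a => ?_) ?_ ha
    · rw [← hsol.bellman_bias]
      exact M.le_bellman h s a
    · rw [← polOp_apply]
      exact congrFun hh s

/-- The maximum of the sum splits because one action attains both maxima; c ≥ 0 keeps the gain
inequality in the right direction. -/
theorem bellman_bias_add_smul (hsol : M.IsModifiedBellmanSolution g h) {c : ℝ} (hc : 0 ≤ c) :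
    M.bellman (h + c • g) = h + (c + 1) • g := by
  funext s
  simp only [Pi.add_apply, Pi.smul_apply, smul_eq_mul]
  apply le_antisymm
  · obtain ⟨a, ha⟩ := M.exists_bellman_eq (h + c • g) s
    rw [ha, nextExp_add, nextExp_smul]
    have h1 := M.le_bellman h s a
    rw [hsol.bellman_bias] at h1
    have h2 := mul_le_mul_of_nonneg_left (hsol.nextExp_gain_le s a) hc
    linarith
  · obtain ⟨a, hg, hh⟩ := hsol.exists_action s
    have h1 := M.le_bellman (h + c • g) s a
    rw [nextExp_add, nextExp_smul, hg] at h1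
    linarith

theorem norm_relaxedVI_sub_le (hsol : M.IsModifiedBellmanSolution g h) (V0 : S → ℝ) (k : ℕ) :
    ‖M.relaxedVI (fun _ => 1 / 2) V0 k - (h + ((k : ℝ) / 2) • g)‖ ≤ ‖V0 - h‖ := by
  induction k with
  | zero => simp [relaxedVI]
  | succ k ih =>
    set W := M.relaxedVI (fun _ => 1 / 2) V0 k
    have e : M.relaxedVI (fun _ => 1 / 2) V0 (k + 1) - (h + (((k + 1 : ℕ) : ℝ) / 2) • g)
        = (1 / 2 : ℝ) • (W - (h + ((k : ℝ) / 2) • g))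
          + (1 / 2 : ℝ) • (M.bellman W - M.bellman (h + ((k : ℝ) / 2) • g)) := by
      rw [hsol.bellman_bias_add_smul (by positivity)]
      simp only [relaxedVI]
      push_cast
      module
    rw [e]
    refine (norm_add_le _ _).trans ?_
    rw [norm_smul, norm_smul, Real.norm_of_nonneg (by norm_num)]
    have := (M.norm_bellman_sub_le W (h + ((k : ℝ) / 2) • g)).trans ih
    linarith

/-- For `V` within `D` of `h + c g`, the one-step value of an action exceeds that of some
gain-preserving action by at most `2 D - c * loss`, where `loss` is the gain it loses. -/
theorem step_le_of_norm_sub_le (hsol : M.IsModifiedBellmanSolution g h) {V : S → ℝ} {c D : ℝ}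
    (hD : ‖V - (h + c • g)‖ ≤ D) (s : S) (a : A) :
    ∃ b, M.nextExp s b g = g s ∧
      M.r s a + M.nextExp s a V + c * (g s - M.nextExp s a g) - 2 * D
        ≤ M.r s b + M.nextExp s b V := by
  obtain ⟨b, hg, hh⟩ := hsol.exists_action s
  refine ⟨b, hg, ?_⟩
  have h1 := abs_le.1 ((M.abs_nextExp_le s a (V - (h + c • g))).trans hD)
  have h2 := abs_le.1 ((M.abs_nextExp_le s b (V - (h + c • g))).trans hD)
  simp only [nextExp_sub, nextExp_add, nextExp_smul, hg] at h1 h2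
  have h3 := M.le_bellman h s a
  rw [hsol.bellman_bias] at h3
  linarith [h1.1, h1.2, h2.1, h2.2]

/-- A weak inequality suffices for one gain-preserving maximizer. `mulVec_gain_of_isGreedy` needs
the strict one, as it must exclude every other action from the support. -/
theorem exists_greedy_action (hsol : M.IsModifiedBellmanSolution g h) {V : S → ℝ} {c D : ℝ}
    (hD : ‖V - (h + c • g)‖ ≤ D) (s : S)
    (hbad : ∀ a, M.nextExp s a g ≠ g s → 2 * D ≤ c * (g s - M.nextExp s a g)) :
    ∃ a, M.nextExp s a g = g s ∧ M.bellman V s = M.r s a + M.nextExp s a V := by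
  obtain ⟨a, ha⟩ := M.exists_bellman_eq V s
  by_cases hag : M.nextExp s a g = g s
  · exact ⟨a, hag, ha⟩
  · obtain ⟨b, hb, hle⟩ := hsol.step_le_of_norm_sub_le hD s a
    refine ⟨b, hb, le_antisymm ?_ (M.le_bellman V s b)⟩
    linarith [hbad a hag]

theorem mulVec_gain_of_isGreedy (hsol : M.IsModifiedBellmanSolution g h) {V : S → ℝ} {c D : ℝ}
    (hD : ‖V - (h + c • g)‖ ≤ D)
    (hbad : ∀ s a, M.nextExp s a g ≠ g s → 2 * D < c * (g s - M.nextExp s a g))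
    {π : M.Policy} (hπ : M.IsGreedy π V) : (M.polMatrix π).mulVec g = g := by
  funext s
  rw [polMatrix_mulVec_apply]
  have hs : ∑ a, (π s).1 a * (M.r s a + M.nextExp s a V) = M.bellman V s := by
    rw [← polOp_apply, hπ]
  have key : ∀ a, (π s).1 a * M.nextExp s a g = (π s).1 a * g s := by
    intro a
    by_cases h0 : (π s).1 a = 0
    · simp [h0]
    · have ha := eq_of_weighted_sum_eq (π s) (fun a => M.le_bellman V s a) hs h0
      by_cases hag : M.nextExp s a g = g s
      · rw [hag]
      · obtain ⟨b, hb, hle⟩ := hsol.step_le_of_norm_sub_le hD s a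
        have := M.le_bellman V s b
        linarith [hbad s a hag]
  rw [Finset.sum_congr rfl fun a _ => key a, ← Finset.sum_mul, (π s).2.2, one_mul]

/-- Altering a gain-preserving deterministic policy at the single state s isolates the loss of one
action. -/
theorem policyGap_le_loss (hsol : M.IsModifiedBellmanSolution g h) {s : S} {a : A}
    (ha : M.nextExp s a g ≠ g s) :
    M.policyGap g ≤ ENNReal.ofReal (g s - M.nextExp s a g) := by
  classical
  choose d hd _ using hsol.exists_action
  have hval : ∀ t, (M.polMatrix (M.ofDet (Function.update d s a))).mulVec g t
      = if t = s then M.nextExp s a g else g t := by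
    intro t
    rw [ofDet_mulVec_apply]
    by_cases hts : t = s
    · subst hts; simp
    · simp [hts, hd]
  have hne : (M.polMatrix (M.ofDet (Function.update d s a))).mulVec g ≠ g := fun hcon => ha <| by
    simpa [hval] using congrFun hcon s
  refine (iInf₂_le (M.ofDet (Function.update d s a)) ⟨⟨_, rfl⟩, hne⟩).trans
    (ENNReal.ofReal_le_ofReal ?_)
  · refine (pi_norm_le_iff_of_nonneg (sub_nonneg.2 (hsol.nextExp_gain_le s a))).2 fun t => ?_
    rw [Pi.sub_apply, hval]
    split_ifs with hts
    · rw [hts, norm_sub_rev, Real.norm_of_nonneg (sub_nonneg.2 (hsol.nextExp_gain_le s a))]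
    · simpa using hsol.nextExp_gain_le s a

/-- Before the threshold there is a step from which on every action that loses gain is
dominated. -/
theorem exists_nat_le_threshold (hsol : M.IsModifiedBellmanSolution g h) (V0 : S → ℝ) :
    ∃ k₀ : ℕ, (k₀ : ℝ) ≤ M.threshold g h V0 ∧
      ∀ s a, M.nextExp s a g ≠ g s → 4 * ‖V0 - h‖ ≤ k₀ * (g s - M.nextExp s a g) := by
  by_cases htop : M.policyGap g = ⊤
  · refine ⟨0, by simp [threshold, htop], fun s a ha => ?_⟩
    have := hsol.policyGap_le_loss ha
    rw [htop] at this
    exact absurd this (by simp)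
  · have hpos := M.policyGap_pos g
    set ε := (M.policyGap g).toReal with hε
    have hεpos : 0 < ε := ENNReal.toReal_pos hpos.ne' htop
    have hεg : ε ≤ 2 * ‖g‖ :=
      ENNReal.toReal_le_of_le_ofReal (by positivity) (M.policyGap_le_of_ne_top g htop)
    -- With c = k/2, the condition 2 D ≤ c ε reads k ≥ 4 D / ε. Rounding up costs at most 1 = ε / ε,
    -- paid by the term 2‖g‖ of K since ε ≤ 2‖g‖.
    refine ⟨⌈4 * ‖V0 - h‖ / ε⌉₊, ?_, fun s a ha => ?_⟩
    · refine (Nat.ceil_lt_add_one (by positivity)).le.trans ?_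
      rw [threshold, ENNReal.toReal_div, ENNReal.toReal_ofReal (by positivity), ← hε,
        div_add_one hεpos.ne', div_le_div_iff_of_pos_right hεpos]
      linarith [norm_nonneg M.r, norm_nonneg V0, norm_nonneg (V0 - h)]
    · have hl : ε ≤ g s - M.nextExp s a g :=
        ENNReal.toReal_le_of_le_ofReal (sub_nonneg.2 (hsol.nextExp_gain_le s a))
          (hsol.policyGap_le_loss ha)
      calc 4 * ‖V0 - h‖ = 4 * ‖V0 - h‖ / ε * ε := by field_simp
        _ ≤ _ := mul_le_mul (Nat.le_ceil _) hl hεpos.le (Nat.cast_nonneg _)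

theorem norm_bellman_sub_sub_gain_le (hsol : M.IsModifiedBellmanSolution g h) (V0 : S → ℝ)
    {k₀ : ℕ} (hk₀ : ∀ s a, M.nextExp s a g ≠ g s →
      4 * ‖V0 - h‖ ≤ k₀ * (g s - M.nextExp s a g)) (m : ℕ) :
    ‖M.bellman (M.relaxedVI (fun _ => 1 / 2) V0 (k₀ + m))
        - M.relaxedVI (fun _ => 1 / 2) V0 (k₀ + m) - g‖
      ≤ 4 * ‖V0 - h‖ / Real.sqrt (Real.pi * (m + 1)) := by
  set V := M.relaxedVI (fun _ => 1 / 2) V0 with hV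
  set c : ℕ → ℝ := fun j => ((k₀ + j : ℕ) : ℝ) / 2 with hc
  have hc0 : ∀ j, 0 ≤ c j := fun j => by simp only [hc]; positivity
  have hck : ∀ j, (k₀ : ℝ) ≤ 2 * c j := fun j => by
    simp only [hc]; push_cast; linarith [Nat.cast_nonneg (α := ℝ) j]
  set x : ℕ → S → ℝ := fun j => V (k₀ + j) - c j • g with hx
  set y : ℕ → S → ℝ := fun j => M.bellman (V (k₀ + j)) - (c j + 1) • g with hy
  have hnear : ∀ j, ‖V (k₀ + j) - (h + c j • g)‖ ≤ ‖V0 - h‖ := fun j =>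
    hsol.norm_relaxedVI_sub_le V0 (k₀ + j)
  have hstep : ∀ j s a, M.nextExp s a g = g s →
      M.r s a + M.nextExp s a (x j) - g s
        = M.r s a + M.nextExp s a (V (k₀ + j)) - (c j + 1) * g s := by
    intro j s a ha
    simp only [hx, nextExp_sub, nextExp_smul, ha]
    ring
  have hydiff : ∀ i j s, y i s - y j s ≤ ‖x i - x j‖ := by
    intro i j s
    -- A gain-preserving maximizer for index i is a competitor for index j, and on it the shifts by
    -- g cancel.
    obtain ⟨a, hag, ha⟩ := hsol.exists_greedy_action (hnear i) s fun a hne => by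
      have h1 := hk₀ s a hne
      have h2 := mul_le_mul_of_nonneg_right (hck i)
        (sub_nonneg.2 (hsol.nextExp_gain_le s a))
      linarith
    have h1 := M.le_bellman (V (k₀ + j)) s a
    have h2 := (abs_le.1 (M.abs_nextExp_le s a (x i - x j))).2
    rw [nextExp_sub] at h2
    have h3 := hstep i s a hag
    have h4 := hstep j s a hag
    simp only [hy, Pi.sub_apply, Pi.smul_apply, smul_eq_mul]
    linarith
  have hxy : ∀ i j, ‖y i - y j‖ ≤ ‖x i - x j‖ := by
    intro i j
    refine (pi_norm_le_iff_of_nonneg (norm_nonneg _)).2 fun s => ?_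
    rw [Pi.sub_apply, Real.norm_eq_abs, abs_le]
    have h1 := hydiff i j s
    have h2 := hydiff j i s
    rw [norm_sub_rev] at h2
    constructor <;> linarith
  have hrec : ∀ n, x (n + 1) = (1 / 2 : ℝ) • x n + (1 / 2 : ℝ) • y n := by
    intro n
    have e : V (k₀ + (n + 1))
        = (1 / 2 : ℝ) • V (k₀ + n) + (1 - 1 / 2 : ℝ) • M.bellman (V (k₀ + n)) := rfl
    simp only [hx, hy, hc, e]
    push_cast
    module
  -- Both x 0 and y n lie within ‖V0 - h‖ of h.
  have hbound : ∀ n, ‖x 0 - y n‖ ≤ 2 * ‖V0 - h‖ := by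
    intro n
    have e : x 0 - y n = (V (k₀ + 0) - (h + c 0 • g))
        - (M.bellman (V (k₀ + n)) - M.bellman (h + c n • g)) := by
      rw [hsol.bellman_bias_add_smul (hc0 n)]
      simp only [hx, hy]
      module
    rw [e]
    refine (norm_sub_le _ _).trans ?_
    have h1 := hnear 0
    have h2 := (M.norm_bellman_sub_le (V (k₀ + n)) (h + c n • g)).trans (hnear n)
    linarith
  have hres := krasnoselskiiMann_residual_le hrec hxy hbound m
  have e : M.bellman (V (k₀ + m)) - V (k₀ + m) - g = -(x m - y m) := by
    simp only [hx, hy]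
    module
  rw [e, norm_neg]
  refine hres.trans (le_of_eq ?_)
  ring

end IsModifiedBellmanSolution

end MDP

/-! ### Main theorem -/

theorem mainTheorem5 {S A : Type*} [Fintype S] [Fintype A] [Nonempty A]
    (M : MDP S A) (g h : S → ℝ) (hsol : M.IsModifiedBellmanSolution g h)
    (V0 : S → ℝ) (V : ℕ → S → ℝ) (hV : V = M.relaxedVI (fun _ => 1 / 2) V0)
    (pol : ℕ → M.Policy) (hpol : ∀ k, M.IsGreedy (pol k) (V k)) :
    0 < M.policyGap g ∧
    ∀ k : ℕ, M.threshold g h V0 < (k : ℝ) →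
      ‖g - M.avgReward (pol k)‖ ≤ ‖M.bellman (V k) - V k - g‖ ∧
      ‖M.bellman (V k) - V k - g‖ ≤
        4 * ‖V0 - h‖ / Real.sqrt (Real.pi * ((k : ℝ) - M.threshold g h V0)) := by
  refine ⟨M.policyGap_pos g, fun k hk => ?_⟩
  obtain ⟨k₀, hk₀, hbad⟩ := hsol.exists_nat_le_threshold V0
  have hlt : (k₀ : ℝ) < k := hk₀.trans_lt hk
  constructor
  · have hD : ‖V k - (h + ((k : ℝ) / 2) • g)‖ ≤ ‖V0 - h‖ := by
      rw [hV]; exact hsol.norm_relaxedVI_sub_le V0 k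
    have hgain := hsol.mulVec_gain_of_isGreedy hD (fun s a ha => by
      have h1 := hbad s a ha
      have h2 : 0 < g s - M.nextExp s a g :=
        sub_pos.2 (lt_of_le_of_ne (hsol.nextExp_gain_le s a) ha)
      have h3 := mul_lt_mul_of_pos_right hlt h2
      linarith) (hpol k)
    have := M.norm_sub_avgReward_le (pol k) hgain (V k)
    rwa [hpol k] at this
  · obtain ⟨m, rfl⟩ := Nat.exists_eq_add_of_le (Nat.cast_lt.1 hlt).le
    rw [hV]
    refine (hsol.norm_bellman_sub_sub_gain_le V0 hbad m).trans ?_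
    have hpos : 0 < Real.pi * (((k₀ + m : ℕ) : ℝ) - M.threshold g h V0) :=
      mul_pos Real.pi_pos (sub_pos.2 hk)
    -- With k = k₀ + m and k₀ ≤ K one has k - K ≤ m ≤ m + 1.
    refine div_le_div_of_nonneg_left (by positivity) (Real.sqrt_pos.2 hpos)
      (Real.sqrt_le_sqrt (mul_le_mul_of_nonneg_left ?_ Real.pi_pos.le))
    push_cast
    linarith
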